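/- Let $X$ be a complex Banach space and $T$ a bounded linear operator on $X$. An operator $S\in L(X)$ is called B-Fredholm if, for some integer $n\ge 0$, the range $R(S^n)$ is closed and the operator $R(S^n)\to R(S^n)$ induced by $S$ is Fredholm; it is called Drazin invertible if it has finite ascent and finite descent, that is, $N(S^n)=N(S^{n+1})$ for some $n\ge 0$ and $R(S^m)=R(S^{m+1})$ for some $m\ge 0$. Let $\sigma_{BF}(T)$ (resp. $\sigma_D(T)$) be the set of all $\lambda\in\mathbb{C}$ such that $T-\lambda I$ is not B-Fredholm (resp. not Drazin invertible). If $\sigma_{BF}(T)$ is a finite (possibly empty) set, then $\sigma_D(T)=\sigma_{BF}(T)$. Moreover, $\sigma(T)\setminus\sigma_{BF}(T)$ is a discrete set consisting of poles of the resolvent $\lambda\mapsto (T-\lambda I)^{-1}$ of $T$, and every accumulation point of $\sigma(T)$ belongs to $\sigma_{BF}(T)$. -/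

import Mathlib

open Filter Topology

namespace BerkaniSpectra

variable {X : Type*} [NormedAddCommGroup X] [NormedSpace ℂ X]

/-- A power `T ^ n` of an operator has a range `R(T ^ n)` that is invariant under `T`. -/
theorem mapsTo_range_pow (T : X →L[ℂ] X) (n : ℕ) :
    Set.MapsTo T (LinearMap.range (T ^ n : X →L[ℂ] X).toLinearMap : Set X)
      (LinearMap.range (T ^ n : X →L[ℂ] X).toLinearMap : Set X) := by
  rintro _ ⟨x, rfl⟩
  refine ⟨T x, ?_⟩
  change (T ^ n * T) x = (T * T ^ n) x
  rw [← pow_succ, ← pow_succ']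

/-- The operator `T_n : R(T ^ n) → R(T ^ n)` induced by `T` on the range of `T ^ n`
(in particular `T_0` is `T`, up to the identification `R(T ^ 0) = X`). -/
noncomputable def inducedOnRange (T : X →L[ℂ] X) (n : ℕ) :
    LinearMap.range (T ^ n : X →L[ℂ] X).toLinearMap →L[ℂ]
      LinearMap.range (T ^ n : X →L[ℂ] X).toLinearMap :=
  T.restrict (mapsTo_range_pow T n)

/-- `T` is B-Fredholm: for some `n ≥ 0` the range of `T ^ n` is closed and the operator induced by
`T` on it is Fredholm. -/
def IsBFredholm (T : X →L[ℂ] X) : Prop :=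
  ∃ n : ℕ, IsClosed (LinearMap.range (T ^ n : X →L[ℂ] X).toLinearMap : Set X) ∧
    (inducedOnRange T n).IsFredholm

/-- The B-Fredholm spectrum `σ_BF(T)`. -/
def bFredholmSpectrum (T : X →L[ℂ] X) : Set ℂ :=
  {μ | ¬ IsBFredholm (T - μ • (1 : X →L[ℂ] X))}

/-- The ascent of `T`: the least `n` with `N(T ^ n) = N(T ^ (n + 1))`, and `⊤` if there is none. -/
noncomputable def ascent (T : X →L[ℂ] X) : ℕ∞ :=
  ⨅ (n : ℕ) (_ : LinearMap.ker (T ^ n : X →L[ℂ] X).toLinearMap =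
    LinearMap.ker (T ^ (n + 1) : X →L[ℂ] X).toLinearMap), (n : ℕ∞)

/-- The descent of `T`: the least `n` with `R(T ^ n) = R(T ^ (n + 1))`, and `⊤` if there is none. -/
noncomputable def descent (T : X →L[ℂ] X) : ℕ∞ :=
  ⨅ (n : ℕ) (_ : LinearMap.range (T ^ n : X →L[ℂ] X).toLinearMap =
    LinearMap.range (T ^ (n + 1) : X →L[ℂ] X).toLinearMap), (n : ℕ∞)

/-- `T` is Drazin invertible: it has finite ascent and finite descent. -/
def IsDrazinInvertible (T : X →L[ℂ] X) : Prop :=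
  ascent T < ⊤ ∧ descent T < ⊤

/-- The Drazin spectrum `σ_D(T)`. -/
def drazinSpectrum (T : X →L[ℂ] X) : Set ℂ :=
  {μ | ¬ IsDrazinInvertible (T - μ • (1 : X →L[ℂ] X))}

/-- `μ` is a pole of the resolvent of `T`: it is an isolated point of the spectrum, and the
resolvent `z ↦ (T - z I)⁻¹`, which is defined on a punctured neighbourhood of `μ`, is meromorphic
at `μ` with negative order. (`Ring.inverse` is the inverse on the resolvent set; its value at `μ`
itself is irrelevant.) -/
def IsPoleOfResolvent (T : X →L[ℂ] X) (μ : ℂ) : Prop :=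
  μ ∈ spectrum ℂ T ∧ (∀ᶠ z in 𝓝[≠] μ, z ∉ spectrum ℂ T) ∧
    MeromorphicAt (fun z : ℂ => Ring.inverse (T - z • (1 : X →L[ℂ] X))) μ ∧
    meromorphicOrderAt (fun z : ℂ => Ring.inverse (T - z • (1 : X →L[ℂ] X))) μ < 0

end BerkaniSpectra

namespace BerkaniSpectra

/-! Off `σ_BF(T)`, put `S = T - μ`; some `S ^ n` has closed range `M`, on which `S` induces a
Fredholm operator `A`. Bordering `A` by its kernel and a complement of its range gives an invertible
operator, and for small `z` invertibility of `A - z` is that of a finite-dimensional analytic block.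
A determinant vanishes identically near `0` or nowhere off `0`, so the resolvent of `A` is nowhere
defined or meromorphic there; `resolvent_dichotomy_of_isBFredholm` carries this over to `S`.

The two alternatives define disjoint open sets covering the complement of `σ_BF(T)`. If `σ_BF(T)` is
finite, that complement is connected and meets the resolvent set, so the meromorphic alternative
holds throughout. Comparing coefficients then gives finite ascent and descent
(`isDrazinInvertible_of_meromorphicAt`). Conversely, finite ascent and descent split `X` as `R(S ^
n) ⊕ N(S ^ n)` with `S` invertible on the first summand. -/

/-! ### Inverses of analytic families in finite dimensions -/

theorem analyticAt_clm_apply {E F : Type*} [NormedAddCommGroup E] [NormedSpace ℂ E]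
    [NormedAddCommGroup F] [NormedSpace ℂ F] (L : E →L[ℂ] F) {f : ℂ → E} {z₀ : ℂ}
    (hf : AnalyticAt ℂ f z₀) : AnalyticAt ℂ (fun z => L (f z)) z₀ :=
  (L.analyticAt _).comp hf

theorem meromorphicAt_clm_apply {E F : Type*} [NormedAddCommGroup E] [NormedSpace ℂ E]
    [NormedAddCommGroup F] [NormedSpace ℂ F] (L : E →L[ℂ] F) {f : ℂ → E} {z₀ : ℂ}
    (hf : MeromorphicAt f z₀) : MeromorphicAt (fun z => L (f z)) z₀ := by
  obtain ⟨n, hn⟩ := hf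
  exact ⟨n, (analyticAt_clm_apply L hn).congr (Eventually.of_forall fun z => by simp)⟩

/-- An analytic family of operators between finite-dimensional spaces is, near a point, either
never invertible off that point or always, and then with a meromorphic family of inverses. -/
theorem analyticAt_matrix_inverse_dichotomy {d : ℕ}
    {B : ℂ → ((Fin d → ℂ) →L[ℂ] (Fin d → ℂ))} {z₀ : ℂ} (hB : AnalyticAt ℂ B z₀) :
    (∀ᶠ z in 𝓝[≠] z₀, ¬ IsUnit (B z)) ∨
      ∃ V : ℂ → ((Fin d → ℂ) →L[ℂ] (Fin d → ℂ)), MeromorphicAt V z₀ ∧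
        ∀ᶠ z in 𝓝[≠] z₀, B z * V z = 1 ∧ V z * B z = 1 := by
  let toM : ((Fin d → ℂ) →L[ℂ] (Fin d → ℂ)) → Matrix (Fin d) (Fin d) ℂ :=
    fun f => LinearMap.toMatrix' f.toLinearMap
  have hent : ∀ i j, AnalyticAt ℂ (fun z => toM (B z) i j) z₀ := by
    intro i j
    have : AnalyticAt ℂ (fun z => (ContinuousLinearMap.proj (R := ℂ) (φ := fun _ : Fin d => ℂ) i)
        ((ContinuousLinearMap.apply ℂ (Fin d → ℂ) (Pi.single j (1 : ℂ) : Fin d → ℂ)) (B z))) z₀ :=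
      analyticAt_clm_apply _ (analyticAt_clm_apply _ hB)
    refine this.congr (Eventually.of_forall fun z => ?_)
    simp [toM, LinearMap.toMatrix'_apply]
  have hdet : ∀ (C : ℂ → Matrix (Fin d) (Fin d) ℂ),
      (∀ i j, AnalyticAt ℂ (fun z => C z i j) z₀) → AnalyticAt ℂ (fun z => (C z).det) z₀ := by
    intro C hC
    simp only [Matrix.det_apply']
    refine Finset.analyticAt_fun_sum _ fun σ _ => analyticAt_const.mul ?_
    exact Finset.analyticAt_fun_prod _ fun i _ => hC _ _
  have hadj : ∀ i j, AnalyticAt ℂ (fun z => (toM (B z)).adjugate i j) z₀ := by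
    intro i j
    simp only [Matrix.adjugate_apply]
    refine hdet _ fun k l => ?_
    rcases eq_or_ne k j with rfl | hk
    · simpa using analyticAt_const
    · simpa [Matrix.updateRow_ne hk] using hent k l
  let toL : Matrix (Fin d) (Fin d) ℂ →ₗ[ℂ] ((Fin d → ℂ) →L[ℂ] (Fin d → ℂ)) :=
    (LinearMap.toContinuousLinearMap (𝕜 := ℂ) (E := Fin d → ℂ) (F' := Fin d → ℂ)).toLinearMap ∘ₗ
      (Matrix.toLin' (R := ℂ) (m := Fin d) (n := Fin d)).toLinearMap
  have htoL : ∀ M (x : Fin d → ℂ), toL M x = M.mulVec x := fun M x => rfl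
  have htoM : ∀ (f : (Fin d → ℂ) →L[ℂ] (Fin d → ℂ)) x, f x = (toM f).mulVec x := by
    intro f x
    simp [toM, LinearMap.toMatrix'_mulVec]
  have hunit : ∀ f : (Fin d → ℂ) →L[ℂ] (Fin d → ℂ), IsUnit f → (toM f).det ≠ 0 := by
    intro f hf
    obtain ⟨g, h1, h2⟩ := isUnit_iff_exists.1 hf
    have : toM f * toM g = 1 := by
      have : f.toLinearMap ∘ₗ g.toLinearMap = LinearMap.id := by
        exact congrArg ContinuousLinearMap.toLinearMap h1
      simp only [toM]
      rw [← LinearMap.toMatrix'_comp, this, LinearMap.toMatrix'_id]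
    intro h0
    have := congrArg Matrix.det this
    simp [h0] at this
  -- Isolated zeros of the determinant; in the second case Cramer's rule gives a meromorphic
  -- inverse.
  rcases (hdet _ hent).eventually_eq_zero_or_eventually_ne_zero with h | h
  · left
    filter_upwards [nhdsWithin_le_nhds h] with z hz hu using hunit _ hu hz
  · right
    refine ⟨fun z => ((toM (B z)).det)⁻¹ • toL (toM (B z)).adjugate, ?_, ?_⟩
    · refine MeromorphicAt.smul ((hdet _ hent).meromorphicAt.inv) (AnalyticAt.meromorphicAt ?_)
      have : (fun z => toL (toM (B z)).adjugate) = fun z => ∑ i, ∑ j,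
          (toM (B z)).adjugate i j • toL (Matrix.single i j 1) := by
        funext z
        conv_lhs => rw [Matrix.matrix_eq_sum_single (toM (B z)).adjugate]
        simp only [map_sum]
        refine Finset.sum_congr rfl fun i _ => Finset.sum_congr rfl fun j _ => ?_
        rw [← map_smul, Matrix.smul_single, smul_eq_mul, mul_one]
      rw [this]
      exact Finset.analyticAt_fun_sum _ fun i _ => Finset.analyticAt_fun_sum _ fun j _ =>
        (hadj i j).smul analyticAt_const
    · filter_upwards [h] with z hz
      constructor
      · ext1 x
        simp only [mul_apply_eq_comp, smul_apply, htoL,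
          htoM (B z), Matrix.mulVec_smul, Matrix.mulVec_mulVec, Matrix.mul_adjugate,
          Matrix.smul_mulVec, Matrix.one_mulVec, smul_smul, inv_mul_cancel₀ hz, one_smul,
          one_apply_eq_self]
      · ext1 x
        simp only [mul_apply_eq_comp, smul_apply, htoL,
          htoM (B z) x, Matrix.mulVec_mulVec, Matrix.adjugate_mul,
          Matrix.smul_mulVec, Matrix.one_mulVec, smul_smul, inv_mul_cancel₀ hz, one_smul,
          one_apply_eq_self]

theorem analyticAt_finiteDimensional_inverse_dichotomy {N F : Type*}
    [NormedAddCommGroup N] [NormedSpace ℂ N] [FiniteDimensional ℂ N]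
    [NormedAddCommGroup F] [NormedSpace ℂ F] [FiniteDimensional ℂ F]
    {B : ℂ → (N →L[ℂ] F)} {z₀ : ℂ} (hB : AnalyticAt ℂ B z₀) :
    (∀ᶠ z in 𝓝[≠] z₀, ¬ ∃ V : F →L[ℂ] N, (B z).comp V = .id ℂ F ∧ V.comp (B z) = .id ℂ N) ∨
      ∃ V : ℂ → (F →L[ℂ] N), MeromorphicAt V z₀ ∧
        ∀ᶠ z in 𝓝[≠] z₀, (B z).comp (V z) = .id ℂ F ∧ (V z).comp (B z) = .id ℂ N := by
  by_cases hd : Module.finrank ℂ N = Module.finrank ℂ F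
  · let d := Module.finrank ℂ N
    let e : N ≃L[ℂ] (Fin d → ℂ) := ContinuousLinearEquiv.ofFinrankEq (by simp [d])
    let e' : F ≃L[ℂ] (Fin d → ℂ) := ContinuousLinearEquiv.ofFinrankEq (by simp [d, hd])
    let conj : (N →L[ℂ] F) →L[ℂ] ((Fin d → ℂ) →L[ℂ] (Fin d → ℂ)) :=
      ((ContinuousLinearMap.compL ℂ (Fin d → ℂ) N (Fin d → ℂ)).flip
        (e.symm : (Fin d → ℂ) →L[ℂ] N)).comp
        (ContinuousLinearMap.compL ℂ N F (Fin d → ℂ) (e' : F →L[ℂ] (Fin d → ℂ)))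
    have hconj : ∀ f x, conj f x = e' (f (e.symm x)) := fun f x => rfl
    let conj' : ((Fin d → ℂ) →L[ℂ] (Fin d → ℂ)) →L[ℂ] (F →L[ℂ] N) :=
      ((ContinuousLinearMap.compL ℂ F (Fin d → ℂ) N).flip
        (e' : F →L[ℂ] (Fin d → ℂ))).comp
        (ContinuousLinearMap.compL ℂ (Fin d → ℂ) (Fin d → ℂ) N (e.symm : (Fin d → ℂ) →L[ℂ] N))
    have hconj' : ∀ f x, conj' f x = e.symm (f (e' x)) := fun f x => rfl
    rcases analyticAt_matrix_inverse_dichotomy (analyticAt_clm_apply conj hB) with h | ⟨V, hV, h⟩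
    · left
      filter_upwards [h] with z hz ⟨V, h1, h2⟩
      refine hz (isUnit_iff_exists.2 ⟨(e : N →L[ℂ] (Fin d → ℂ)).comp
        (V.comp (e'.symm : (Fin d → ℂ) →L[ℂ] F)), ?_, ?_⟩)
      · ext1 x
        have := congr($h1 (e'.symm x))
        simp only [ContinuousLinearMap.comp_apply, ContinuousLinearMap.id_apply] at this
        simp [hconj, this]
      · ext1 x
        have := congr($h2 (e.symm x))
        simp only [ContinuousLinearMap.comp_apply, ContinuousLinearMap.id_apply] at this
        simp [hconj, this]
    · right
      refine ⟨fun z => conj' (V z), ?_, ?_⟩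
      · exact meromorphicAt_clm_apply conj' hV
      · filter_upwards [h] with z ⟨h1, h2⟩
        constructor
        · ext1 x
          have := congr(e'.symm ($h1 (e' x)))
          simpa [hconj, hconj'] using this
        · ext1 x
          have := congr(e.symm ($h2 (e x)))
          simpa [hconj, hconj'] using this
  · left
    refine Eventually.of_forall fun z ⟨V, h1, h2⟩ => hd ?_
    exact LinearEquiv.finrank_eq (LinearEquiv.ofLinearMap (B z).toLinearMap V.toLinearMap
      (by ext1 x; exact congr($h1 x)) (by ext1 x; exact congr($h2 x)))

/-! ### Bordered operators and resolvents of Fredholm operators -/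

/-- The bordered operator with blocks `A`, `ι`, `π` and `0`. -/
noncomputable def bordered {M N F : Type*} [NormedAddCommGroup M] [NormedSpace ℂ M]
    [NormedAddCommGroup N] [NormedSpace ℂ N] [NormedAddCommGroup F] [NormedSpace ℂ F]
    (A : M →L[ℂ] M) (ι : F →L[ℂ] M) (π : M →L[ℂ] N) : M × F →L[ℂ] M × N :=
  (A.coprod ι).prod (π.comp (ContinuousLinearMap.fst ℂ M F))

/-- If a bordered operator is bijective, the resolvent of the corner `A` is, near `0`, either
nowhere defined or meromorphic. -/
theorem resolvent_dichotomy_of_bordered {M N F : Type*}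
    [NormedAddCommGroup M] [NormedSpace ℂ M] [CompleteSpace M]
    [NormedAddCommGroup N] [NormedSpace ℂ N] [FiniteDimensional ℂ N]
    [NormedAddCommGroup F] [NormedSpace ℂ F] [FiniteDimensional ℂ F]
    (A : M →L[ℂ] M) (ι : F →L[ℂ] M) (π : M →L[ℂ] N)
    (hbij : Function.Bijective (bordered A ι π)) :
    (∀ᶠ z in 𝓝[≠] (0 : ℂ), ¬ IsUnit (A - z • (1 : M →L[ℂ] M))) ∨
      ∃ R : ℂ → (M →L[ℂ] M), MeromorphicAt R 0 ∧ ∀ᶠ z in 𝓝[≠] (0 : ℂ),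
        (A - z • (1 : M →L[ℂ] M)) * R z = 1 ∧ R z * (A - z • (1 : M →L[ℂ] M)) = 1 := by
  have : CompleteSpace N := FiniteDimensional.complete ℂ N
  have : CompleteSpace F := FiniteDimensional.complete ℂ F
  let P₀ : (M × F) ≃L[ℂ] (M × N) := ContinuousLinearEquiv.ofBijective (bordered A ι π)
    (LinearMap.ker_eq_bot.2 hbij.1) (LinearMap.range_eq_top.2 hbij.2)
  let D : M × F →L[ℂ] M × N :=
    (ContinuousLinearMap.inl ℂ M N).comp (ContinuousLinearMap.fst ℂ M F)
  -- With this `Q`, the bordered operator of `A - z` is `P₀ (1 - z Q)`, so it has the analytic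
  -- inverse `W z` for small `z`.
  let Q : M × F →L[ℂ] M × F := (P₀.symm : M × N →L[ℂ] M × F).comp D
  let W : ℂ → (M × N →L[ℂ] M × F) := fun z =>
    (Ring.inverse (1 - z • Q)).comp (P₀.symm : M × N →L[ℂ] M × F)
  have hQan : AnalyticAt ℂ (fun z : ℂ => 1 - z • Q) 0 :=
    analyticAt_const.sub (analyticAt_id.smul analyticAt_const)
  have hW : AnalyticAt ℂ W 0 := by
    refine analyticAt_clm_apply ((ContinuousLinearMap.compL ℂ (M × N) (M × F) (M × F)).flip
      (P₀.symm : M × N →L[ℂ] M × F)) ?_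
    refine AnalyticAt.fun_comp (g := Ring.inverse) ?_ hQan
    have := analyticAt_inverse (𝕜 := ℂ) (1 : (M × F →L[ℂ] M × F)ˣ)
    simpa using this
  have hunit : ∀ᶠ z in 𝓝 (0 : ℂ), IsUnit (1 - z • Q) := by
    refine hQan.continuousAt.eventually (Units.isOpen.mem_nhds ?_)
    simp
  have hPQ : ∀ (z : ℂ) (v : M × F), bordered (A - z • (1 : M →L[ℂ] M)) ι π v = P₀ ((1 - z • Q : M × F →L[ℂ] M × F) v) := by
    intro z v
    have h1 : P₀ v = bordered A ι π v := rfl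
    have h2 : P₀ (Q v) = D v := P₀.apply_symm_apply _
    have h3 : (1 - z • Q : M × F →L[ℂ] M × F) v = v - z • Q v := rfl
    rw [h3, map_sub, map_smul, h2, h1]
    ext <;> simp [bordered, D]
    abel
  have hPW : ∀ᶠ z in 𝓝 (0 : ℂ), (∀ v, bordered (A - z • (1 : M →L[ℂ] M)) ι π (W z v) = v) ∧
      ∀ v, W z (bordered (A - z • (1 : M →L[ℂ] M)) ι π v) = v := by
    filter_upwards [hunit] with z hz
    constructor
    · intro v
      rw [hPQ]
      have : (1 - z • Q : M × F →L[ℂ] M × F) (W z v) = P₀.symm v :=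
        congr($(Ring.mul_inverse_cancel _ hz) (P₀.symm v))
      rw [this, P₀.apply_symm_apply]
    · intro v
      rw [hPQ]
      change Ring.inverse (1 - z • Q) (P₀.symm (P₀ _)) = v
      rw [P₀.symm_apply_apply]
      exact congr($(Ring.inverse_mul_cancel _ hz) v)
  -- The four blocks of `W z`; `Emp` is the finite-dimensional one that decides invertibility of `A
  -- - z`.
  let E : ℂ → (M →L[ℂ] M) := fun z =>
    (ContinuousLinearMap.fst ℂ M F).comp ((W z).comp (ContinuousLinearMap.inl ℂ M N))
  let Ep : ℂ → (N →L[ℂ] M) := fun z =>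
    (ContinuousLinearMap.fst ℂ M F).comp ((W z).comp (ContinuousLinearMap.inr ℂ M N))
  let Em : ℂ → (M →L[ℂ] F) := fun z =>
    (ContinuousLinearMap.snd ℂ M F).comp ((W z).comp (ContinuousLinearMap.inl ℂ M N))
  let Emp : ℂ → (N →L[ℂ] F) := fun z =>
    (ContinuousLinearMap.snd ℂ M F).comp ((W z).comp (ContinuousLinearMap.inr ℂ M N))
  have hE : AnalyticAt ℂ E 0 :=
    analyticAt_clm_apply (ContinuousLinearMap.compL ℂ _ _ _ (ContinuousLinearMap.fst ℂ M F))
      (analyticAt_clm_apply ((ContinuousLinearMap.compL ℂ _ _ _).flip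
        (ContinuousLinearMap.inl ℂ M N)) hW)
  have hEp : AnalyticAt ℂ Ep 0 :=
    analyticAt_clm_apply (ContinuousLinearMap.compL ℂ _ _ _ (ContinuousLinearMap.fst ℂ M F))
      (analyticAt_clm_apply ((ContinuousLinearMap.compL ℂ _ _ _).flip
        (ContinuousLinearMap.inr ℂ M N)) hW)
  have hEm : AnalyticAt ℂ Em 0 :=
    analyticAt_clm_apply (ContinuousLinearMap.compL ℂ _ _ _ (ContinuousLinearMap.snd ℂ M F))
      (analyticAt_clm_apply ((ContinuousLinearMap.compL ℂ _ _ _).flip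
        (ContinuousLinearMap.inl ℂ M N)) hW)
  have hEmp : AnalyticAt ℂ Emp 0 :=
    analyticAt_clm_apply (ContinuousLinearMap.compL ℂ _ _ _ (ContinuousLinearMap.snd ℂ M F))
      (analyticAt_clm_apply ((ContinuousLinearMap.compL ℂ _ _ _).flip
        (ContinuousLinearMap.inr ℂ M N)) hW)
  have hrel : ∀ᶠ z in 𝓝[≠] (0 : ℂ),
      (∀ x, (A - z • (1 : M →L[ℂ] M)) (E z x) + ι (Em z x) = x) ∧
      (∀ y, (A - z • (1 : M →L[ℂ] M)) (Ep z y) + ι (Emp z y) = 0) ∧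
      (∀ y, π (Ep z y) = y) ∧
      (∀ x, E z ((A - z • (1 : M →L[ℂ] M)) x) + Ep z (π x) = x) ∧
      (∀ x, Em z ((A - z • (1 : M →L[ℂ] M)) x) + Emp z (π x) = 0) ∧
      (∀ y, Em z (ι y) = y) := by
    filter_upwards [nhdsWithin_le_nhds hPW] with z ⟨h1, h2⟩
    have hsplit : ∀ x y, W z (x, y) = (E z x + Ep z y, Em z x + Emp z y) := by
      intro x y
      have : ((x, y) : M × N) = (x, 0) + (0, y) := by simp
      rw [this, map_add]
      rfl
    have hb : ∀ x y, bordered (A - z • (1 : M →L[ℂ] M)) ι π (x, y) =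
        ((A - z • (1 : M →L[ℂ] M)) x + ι y, π x) := fun x y => rfl
    refine ⟨fun x => ?_, fun y => ?_, fun y => ?_, fun x => ?_, fun x => ?_, fun y => ?_⟩
    · have := h1 (x, 0)
      rw [hsplit, hb] at this
      simpa using congrArg Prod.fst this
    · have := h1 (0, y)
      rw [hsplit, hb] at this
      simpa using congrArg Prod.fst this
    · have := h1 (0, y)
      rw [hsplit, hb] at this
      simpa using congrArg Prod.snd this
    · have := h2 (x, 0)
      rw [hb, hsplit] at this
      simpa using congrArg Prod.fst this
    · have := h2 (x, 0)
      rw [hb, hsplit] at this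
      simpa using congrArg Prod.snd this
    · have := h2 (0, y)
      rw [hb, hsplit] at this
      simpa using congrArg Prod.snd this
  clear_value E Ep Em Emp
  rcases analyticAt_finiteDimensional_inverse_dichotomy hEmp with h | ⟨V, hV, h⟩
  · left
    filter_upwards [h, hrel] with z hz ⟨r1, r2, r3, r4, r5, r6⟩ hu
    obtain ⟨R, hR1, hR2⟩ := isUnit_iff_exists.1 hu
    have hR1' : ∀ x, (A - z • (1 : M →L[ℂ] M)) (R x) = x := fun x => congr($hR1 x)
    have hR2' : ∀ x, R ((A - z • (1 : M →L[ℂ] M)) x) = x := fun x => congr($hR2 x)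
    -- Schur complement: if `R` inverts `A - z`, then `-π R ι` inverts `Emp z`.
    refine hz ⟨-(π.comp (R.comp ι)), ?_, ?_⟩
    · ext1 y
      have h5 := r5 (R (ι y))
      rw [hR1', r6] at h5
      simpa using (eq_neg_of_add_eq_zero_left h5).symm
    · ext1 y
      have h2 := congrArg (fun x => π (R x)) (r2 y)
      simp only [map_add, hR2', r3, map_zero] at h2
      simpa using (eq_neg_of_add_eq_zero_left h2).symm
  · right
    -- The converse Schur formula, with `V z` the inverse of `Emp z`.
    refine ⟨fun z => E z - (Ep z).comp ((V z).comp (Em z)), ?_, ?_⟩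
    · refine hE.meromorphicAt.sub ?_
      obtain ⟨n, hn⟩ := hV
      refine ⟨n, ?_⟩
      have h1 := ((ContinuousLinearMap.compL ℂ M F N).analyticAt_bilinear _).comp₂ hn hEm
      have h2 := ((ContinuousLinearMap.compL ℂ M N M).analyticAt_bilinear _).comp₂ hEp h1
      refine h2.congr (Eventually.of_forall fun z => ?_)
      simp
    · filter_upwards [h, hrel] with z ⟨v1, v2⟩ ⟨r1, r2, r3, r4, r5, r6⟩
      have v1' : ∀ x, Emp z (V z x) = x := fun x => congr($v1 x)
      have v2' : ∀ x, V z (Emp z x) = x := fun x => congr($v2 x)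
      constructor
      · ext1 x
        have h2 := r2 (V z (Em z x))
        rw [v1'] at h2
        change (A - z • (1 : M →L[ℂ] M)) (E z x - Ep z (V z (Em z x))) = x
        rw [map_sub, eq_neg_of_add_eq_zero_left h2, sub_neg_eq_add, r1]
      · ext1 x
        change E z ((A - z • (1 : M →L[ℂ] M)) x) -
          Ep z (V z (Em z ((A - z • (1 : M →L[ℂ] M)) x))) = x
        rw [eq_neg_of_add_eq_zero_left (r5 x), map_neg, v2', map_neg, sub_neg_eq_add, r4]

/-- The resolvent of a Fredholm operator is, near `0`, either nowhere defined or meromorphic. -/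
theorem resolvent_dichotomy_of_isFredholm {M : Type*}
    [NormedAddCommGroup M] [NormedSpace ℂ M] [CompleteSpace M]
    {A : M →L[ℂ] M} (hA : A.IsFredholm) :
    (∀ᶠ z in 𝓝[≠] (0 : ℂ), ¬ IsUnit (A - z • (1 : M →L[ℂ] M))) ∨
      ∃ R : ℂ → (M →L[ℂ] M), MeromorphicAt R 0 ∧ ∀ᶠ z in 𝓝[≠] (0 : ℂ),
        (A - z • (1 : M →L[ℂ] M)) * R z = 1 ∧ R z * (A - z • (1 : M →L[ℂ] M)) = 1 := by
  obtain ⟨pkg⟩ := hA.nonempty_fredholmPackage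
  have := pkg.decDom.finite_X₀
  have := pkg.decCodom.finite_X₀
  let π := pkg.decDom.X₀.projectionOntoL pkg.decDom.X₁ pkg.decDom.isTopCompl.symm
  have hker : ∀ x, A x = 0 ↔ x ∈ pkg.decDom.X₀ := fun x => by
    rw [← pkg.ker_eq]; rfl
  have hran : ∀ x, A x ∈ pkg.decCodom.X₁ := fun x => by
    rw [← pkg.range_eq]; exact ⟨x, rfl⟩
  have hπ : ∀ x (hx : x ∈ pkg.decDom.X₀), π x = ⟨x, hx⟩ := fun x hx =>
    Submodule.projectionOntoL_apply_left _ (⟨x, hx⟩ : pkg.decDom.X₀)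
  refine resolvent_dichotomy_of_bordered A pkg.decCodom.X₀.subtypeL π ⟨?_, ?_⟩
  · refine (injective_iff_map_eq_zero _).2 ?_
    rintro ⟨x, y⟩ h
    have h1 : A x + (y : M) = 0 := congrArg Prod.fst h
    have h2 : π x = 0 := congrArg Prod.snd h
    have hy : (y : M) = 0 := by
      refine (Submodule.disjoint_def.1 pkg.decCodom.isTopCompl.isCompl.disjoint) _ ?_ y.2
      rw [eq_neg_of_add_eq_zero_right h1]
      exact neg_mem (hran x)
    have hx : A x = 0 := by simpa [hy] using h1
    have := hπ x ((hker x).1 hx)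
    rw [h2] at this
    have hx0 : x = 0 := (congrArg Subtype.val this).symm
    ext <;> simp [hx0, hy]
  · rintro ⟨v, w⟩
    obtain ⟨a, ha, b, hb, rfl⟩ := Submodule.mem_sup.1
      (pkg.decCodom.isTopCompl.isCompl.sup_eq_top ▸ Submodule.mem_top (x := v))
    rw [← pkg.range_eq] at ha
    obtain ⟨u, rfl⟩ := ha
    -- Replacing the kernel component of `u` by `w` leaves its image under `A` unchanged.
    refine ⟨(u - π u + w, ⟨b, hb⟩), ?_⟩
    have e1 : A (π u : M) = 0 := (hker _).2 (π u).2
    have e2 : A (w : M) = 0 := (hker _).2 w.2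
    refine Prod.ext ?_ ?_
    · change A (u - π u + w) + b = A u + b
      simp [e1, e2]
    · change π (u - π u + w) = w
      rw [map_add, map_sub, hπ _ (π u).2, hπ _ w.2]
      simp

variable {X : Type*} [NormedAddCommGroup X] [NormedSpace ℂ X]

/-! ### From the range of a power to the whole space -/

/-- The factorization of `S ^ n - w ^ n` by `S - w`. -/
theorem exists_analytic_pow_sub_pow_factor (S : X →L[ℂ] X) (n : ℕ) :
    ∃ p : ℂ → (X →L[ℂ] X), (∀ w, AnalyticAt ℂ p w) ∧ ∀ w,
      (S - w • (1 : X →L[ℂ] X)) * p w = S ^ n - w ^ n • (1 : X →L[ℂ] X) ∧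
      p w * (S - w • (1 : X →L[ℂ] X)) = S ^ n - w ^ n • (1 : X →L[ℂ] X) := by
  induction n with
  | zero => exact ⟨fun _ => 0, fun w => analyticAt_const, fun w => by simp⟩
  | succ n ih =>
    obtain ⟨p, hp, h⟩ := ih
    refine ⟨fun w => S ^ n + w • p w, fun w => analyticAt_const.add (analyticAt_id.smul (hp w)),
      fun w => ⟨?_, ?_⟩⟩
    · rw [mul_add, mul_smul_comm, (h w).1, sub_mul, ← pow_succ', smul_mul_assoc, one_mul, smul_sub,
        smul_smul, ← pow_succ']
      abel
    · rw [add_mul, smul_mul_assoc, (h w).2, mul_sub, ← pow_succ, mul_smul_comm, mul_one, smul_sub,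
        smul_smul, ← pow_succ']
      abel

/-- The resolvent of a B-Fredholm operator is, near `0`, either nowhere defined or meromorphic. -/
theorem resolvent_dichotomy_of_isBFredholm [CompleteSpace X] {S : X →L[ℂ] X}
    (hS : IsBFredholm S) :
    (∀ᶠ z in 𝓝[≠] (0 : ℂ), ¬ IsUnit (S - z • (1 : X →L[ℂ] X))) ∨
      ∃ R : ℂ → (X →L[ℂ] X), MeromorphicAt R 0 ∧ ∀ᶠ z in 𝓝[≠] (0 : ℂ),
        (S - z • (1 : X →L[ℂ] X)) * R z = 1 ∧ R z * (S - z • (1 : X →L[ℂ] X)) = 1 := by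
  obtain ⟨n, hcl, hfr⟩ := hS
  obtain ⟨p, hp, hgeom⟩ := exists_analytic_pow_sub_pow_factor S n
  set M := LinearMap.range (S ^ n : X →L[ℂ] X).toLinearMap with hM
  have : CompleteSpace M := hcl.completeSpace_coe
  set A : M →L[ℂ] M := inducedOnRange S n with hA
  let σ : X →L[ℂ] M := (S ^ n).codRestrict M fun x => ⟨x, rfl⟩
  have hAz : ∀ (z : ℂ) (m : M), (((A - z • (1 : M →L[ℂ] M)) m : M) : X) =
      (S - z • (1 : X →L[ℂ] X)) m := fun z m => rfl
  have hcomm : ∀ (z : ℂ) (x : X), σ ((S - z • (1 : X →L[ℂ] X)) x) =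
      (A - z • (1 : M →L[ℂ] M)) (σ x) := by
    intro z x
    apply Subtype.ext
    rw [hAz]
    change (S ^ n * (S - z • (1 : X →L[ℂ] X))) x = ((S - z • (1 : X →L[ℂ] X)) * S ^ n) x
    congr 1
    rw [mul_sub, sub_mul, ← pow_succ, ← pow_succ']
    simp
  rcases resolvent_dichotomy_of_isFredholm hfr with h | ⟨R, hR, h⟩
  · left
    filter_upwards [h, self_mem_nhdsWithin] with z hz hz0 hu
    -- Injectivity of `S - z` restricts to `M`; surjectivity passes to `A - z` through the
    -- intertwiner `σ`.
    refine hz (ContinuousLinearMap.isUnit_iff_bijective.2 ⟨?_, ?_⟩)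
    · intro a b hab
      refine Subtype.ext ((ContinuousLinearMap.isUnit_iff_bijective.1 hu).1 ?_)
      rw [← hAz, ← hAz, hab]
    · rintro ⟨_, y, rfl⟩
      obtain ⟨w, rfl⟩ := (ContinuousLinearMap.isUnit_iff_bijective.1 hu).2 y
      exact ⟨σ w, (hcomm z w).symm⟩
  · right
    -- `S - z` sends `R z ∘ σ` to `S ^ n` and `p z` to `S ^ n - z ^ n`; the difference is `z ^ n`.
    refine ⟨fun z => (z ^ n)⁻¹ • (M.subtypeL.comp ((R z).comp σ) - p z), ?_, ?_⟩
    · refine MeromorphicAt.smul ((analyticAt_id.pow n).meromorphicAt.inv) (.sub ?_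
        (hp 0).meromorphicAt)
      exact meromorphicAt_clm_apply (ContinuousLinearMap.compL ℂ X M X M.subtypeL)
        (meromorphicAt_clm_apply ((ContinuousLinearMap.compL ℂ X M M).flip σ) hR)
    · filter_upwards [h, self_mem_nhdsWithin] with z ⟨h1, h2⟩ hz0
      have hzn : z ^ n ≠ 0 := pow_ne_zero _ hz0
      have key : ∀ B : X →L[ℂ] X, B = S ^ n → (z ^ n)⁻¹ •
          (B - (S ^ n - z ^ n • (1 : X →L[ℂ] X))) = 1 := by
        rintro B rfl
        rw [sub_sub_cancel, smul_smul, inv_mul_cancel₀ hzn, one_smul]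
      constructor
      · rw [mul_smul_comm, mul_sub, (hgeom z).1]
        refine key _ ?_
        ext1 x
        have := congr((($h1 (σ x) : M) : X))
        exact this
      · rw [smul_mul_assoc, sub_mul, (hgeom z).2]
        refine key _ ?_
        ext1 x
        change ((R z (σ ((S - z • (1 : X →L[ℂ] X)) x)) : M) : X) = _
        rw [hcomm]
        exact congr((($h2 (σ x) : M) : X))

/-! ### Meromorphic resolvents and Drazin invertibility -/

/-- If the image of an analytic function under `L` has a leading coefficient `c`, then `c` is in
the range of `L`. -/
theorem exists_apply_eq_of_eventually_eq_pow_smul {E F : Type*}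
    [NormedAddCommGroup E] [NormedSpace ℂ E] [NormedAddCommGroup F] [NormedSpace ℂ F]
    (L : E →L[ℂ] F) {H : ℂ → F} (hH : ContinuousAt H 0) (c : F) (k : ℕ) :
    ∀ {f : ℂ → E}, AnalyticAt ℂ f 0 →
      (∀ᶠ z in 𝓝[≠] (0 : ℂ), L (f z) = z ^ k • (c + z • H z)) → ∃ d, L d = c := by
  have key : ∀ (j : ℕ) {f : ℂ → E}, AnalyticAt ℂ f 0 →
      (∀ᶠ z in 𝓝[≠] (0 : ℂ), L (f z) = z ^ j • (c + z • H z)) → L (f 0) = (0 : ℂ) ^ j • c := by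
    intro j f hf h
    have h1 : Tendsto (fun z => L (f z)) (𝓝[≠] 0) (𝓝 (L (f 0))) :=
      ((L.continuous.continuousAt).comp hf.continuousAt).tendsto.mono_left nhdsWithin_le_nhds
    have hc : ContinuousAt (fun z : ℂ => z ^ j • (c + z • H z)) 0 :=
      (continuousAt_id.pow j).smul (continuousAt_const.add (continuousAt_id.smul hH))
    have h2 := hc.tendsto.mono_left (nhdsWithin_le_nhds (s := {(0 : ℂ)}ᶜ))
    simpa using tendsto_nhds_unique (h1.congr' h) h2
  induction k with
  | zero => exact fun hf h => ⟨_, by simpa using key 0 hf h⟩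
  | succ k ih =>
    intro f hf h
    have h0 : L (f 0) = 0 := by simpa using key _ hf h
    obtain ⟨q, hq⟩ := hf
    -- As `L (f 0) = 0`, dividing `f - f 0` by `z` lowers the exponent by one.
    refine ih (f := dslope f 0) ⟨_, hq.has_fpower_series_dslope_fslope⟩ ?_
    filter_upwards [h, self_mem_nhdsWithin] with z hz hz0
    have hz0 : z ≠ 0 := hz0
    rw [dslope_of_ne _ hz0, slope_def_module, sub_zero, map_smul, map_sub, h0, sub_zero, hz,
      smul_smul, pow_succ', inv_mul_cancel_left₀ hz0]

/-- An operator whose resolvent is meromorphic at `0` has finite ascent and finite descent. -/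
theorem isDrazinInvertible_of_meromorphicAt {S : X →L[ℂ] X} {R : ℂ → (X →L[ℂ] X)}
    (hR : MeromorphicAt R 0) (h : ∀ᶠ z in 𝓝[≠] (0 : ℂ),
      (S - z • (1 : X →L[ℂ] X)) * R z = 1 ∧ R z * (S - z • (1 : X →L[ℂ] X)) = 1) :
    IsDrazinInvertible S := by
  obtain ⟨k, hk⟩ := hR
  simp only [sub_zero] at hk
  obtain ⟨p, hp, hgeom⟩ := exists_analytic_pow_sub_pow_factor S k
  have hH : ContinuousAt (fun z => z ^ k • R z + p z) 0 :=
    hk.continuousAt.add (hp 0).continuousAt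
  have hl : ∀ z, (S ^ k + z • p z) * (S - z • (1 : X →L[ℂ] X)) =
      S ^ (k + 1) - z ^ (k + 1) • (1 : X →L[ℂ] X) := by
    intro z
    rw [add_mul, smul_mul_assoc, (hgeom z).2, mul_sub, ← pow_succ, mul_smul_comm, mul_one, smul_sub,
      smul_smul, ← pow_succ']
    abel
  have hr : ∀ z, (S - z • (1 : X →L[ℂ] X)) * (S ^ k + z • p z) =
      S ^ (k + 1) - z ^ (k + 1) • (1 : X →L[ℂ] X) := by
    intro z
    rw [mul_add, mul_smul_comm, (hgeom z).1, sub_mul, ← pow_succ', smul_mul_assoc, one_mul,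
      smul_sub, smul_smul, ← pow_succ']
    abel
  -- Here `S ^ (k + 1) * R z = S ^ k + z • (p z + z ^ k • R z)`, and multiplying by `z ^ k` makes
  -- both sides analytic. The outcome is `S ^ (k + 1) * D = S ^ k`, which bounds the descent; the
  -- mirror identity for `D'` bounds the ascent.
  obtain ⟨D, hD⟩ := exists_apply_eq_of_eventually_eq_pow_smul
    (ContinuousLinearMap.mul ℂ (X →L[ℂ] X) (S ^ (k + 1))) hH (S ^ k) k hk (by
      filter_upwards [h] with z ⟨h1, _⟩
      have e := congrArg (· * R z) (hl z)
      simp only [mul_assoc, h1, mul_one, sub_mul, smul_mul_assoc, one_mul] at e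
      rw [ContinuousLinearMap.mul_apply', mul_smul_comm, eq_add_of_sub_eq e.symm]
      simp only [smul_add, smul_smul, pow_succ']
      abel)
  obtain ⟨D', hD'⟩ := exists_apply_eq_of_eventually_eq_pow_smul
    ((ContinuousLinearMap.mul ℂ (X →L[ℂ] X)).flip (S ^ (k + 1))) hH (S ^ k) k hk (by
      filter_upwards [h] with z ⟨_, h2⟩
      have e := congrArg (R z * ·) (hr z)
      simp only [← mul_assoc, h2, one_mul, mul_sub, mul_smul_comm, mul_one] at e
      rw [ContinuousLinearMap.flip_apply, ContinuousLinearMap.mul_apply', smul_mul_assoc,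
        eq_add_of_sub_eq e.symm]
      simp only [smul_add, smul_smul, pow_succ']
      abel)
  rw [ContinuousLinearMap.mul_apply'] at hD
  rw [ContinuousLinearMap.flip_apply, ContinuousLinearMap.mul_apply'] at hD'
  constructor
  · refine (iInf₂_le k ?_).trans_lt (ENat.natCast_lt_top k)
    apply le_antisymm
    · intro x hx
      have hx : (S ^ k) x = 0 := hx
      change (S ^ (k + 1)) x = 0
      rw [pow_succ']
      simp [hx]
    · intro x hx
      have hx : (S ^ (k + 1)) x = 0 := hx
      change (S ^ k) x = 0
      rw [← hD']
      simp [hx]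
  · refine (iInf₂_le k ?_).trans_lt (ENat.natCast_lt_top k)
    apply le_antisymm
    · rintro _ ⟨x, rfl⟩
      exact ⟨D x, congr($hD x)⟩
    · rintro _ ⟨x, rfl⟩
      refine ⟨S x, ?_⟩
      change (S ^ k * S) x = _
      rw [← pow_succ]
      rfl

theorem isFredholm_of_isUnit [CompleteSpace X] {A : X →L[ℂ] X} (hA : IsUnit A) :
    A.IsFredholm := by
  obtain ⟨u, rfl⟩ := hA
  let e : X ≃L[ℂ] X := ContinuousLinearEquiv.unitsEquiv ℂ X u
  have he : ((u : X →L[ℂ] X) : X → X) = e := rfl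
  have hk : LinearMap.ker (u : X →L[ℂ] X).toLinearMap = ⊥ := LinearMap.ker_eq_bot.2 e.injective
  have hr : LinearMap.range (u : X →L[ℂ] X).toLinearMap = ⊤ :=
    LinearMap.range_eq_top.2 e.surjective
  refine ⟨he ▸ e.toHomeomorph.isOpenMap.isStrictMap e.continuous, ?_, ?_, ?_, ?_⟩
  · rw [hr]; exact isClosed_univ
  · rw [hk]; infer_instance
  · rw [hr]; infer_instance
  · rw [hk]; exact Submodule.closedComplemented_bot

/-- Past both stabilization indices, `R(S ^ n)` and `N(S ^ n)` are complementary. An operator range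
with a closed complement is closed, and `S` is bijective on `R(S ^ n)`. -/
theorem isBFredholm_of_isDrazinInvertible [CompleteSpace X] {S : X →L[ℂ] X}
    (hS : IsDrazinInvertible S) : IsBFredholm S := by
  obtain ⟨ha, hd⟩ := hS
  simp only [ascent, iInf_lt_iff] at ha
  simp only [descent, iInf_lt_iff] at hd
  obtain ⟨a, ha, -⟩ := ha
  obtain ⟨d, hd, -⟩ := hd
  have hker : ∀ m x, a ≤ m → (S ^ (m + 1)) x = 0 → (S ^ m) x = 0 := by
    intro m x hm hx
    obtain ⟨j, rfl⟩ := Nat.exists_eq_add_of_le hm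
    have e : (S ^ (a + 1)) ((S ^ j) x) = 0 := by
      rw [← hx, ← mul_apply_eq_comp, ← pow_add]; congr 2; ring
    have e' : (S ^ j) x ∈ LinearMap.ker (S ^ (a + 1) : X →L[ℂ] X).toLinearMap := e
    rw [← ha] at e'
    rw [pow_add]
    exact e'
  have hran : ∀ m x, d ≤ m → ∃ y, (S ^ (m + 1)) y = (S ^ m) x := by
    intro m x hm
    obtain ⟨j, rfl⟩ := Nat.exists_eq_add_of_le' hm
    have e : (S ^ d) x ∈ LinearMap.range (S ^ d : X →L[ℂ] X).toLinearMap := ⟨x, rfl⟩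
    rw [hd] at e
    obtain ⟨y, hy⟩ := e
    have hy : (S ^ (d + 1)) y = (S ^ d) x := hy
    refine ⟨y, ?_⟩
    rw [add_assoc, pow_add S j, pow_add S j, mul_apply_eq_comp, mul_apply_eq_comp, hy]
  have hker' : ∀ m j x, a ≤ m → (S ^ (m + j)) x = 0 → (S ^ m) x = 0 := by
    intro m j x hm
    induction j with
    | zero => exact id
    | succ j ih => exact fun hx => ih (hker _ _ (hm.trans (Nat.le_add_right _ _)) hx)
  have hran' : ∀ m j x, d ≤ m → ∃ y, (S ^ (m + j)) y = (S ^ m) x := by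
    intro m j x hm
    induction j with
    | zero => exact ⟨x, rfl⟩
    | succ j ih =>
      obtain ⟨y, hy⟩ := ih
      obtain ⟨y', hy'⟩ := hran (m + j) y (hm.trans (Nat.le_add_right _ _))
      exact ⟨y', hy'.trans hy⟩
  let n := max a d
  have hna : a ≤ n := le_max_left _ _
  have hnd : d ≤ n := le_max_right _ _
  have hcl : IsClosed (LinearMap.range (S ^ n : X →L[ℂ] X).toLinearMap : Set X) := by
    let K := LinearMap.ker (S ^ n : X →L[ℂ] X).toLinearMap
    have hK : IsClosed (K : Set X) := (S ^ n).isClosed_ker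
    -- The closed-range criterion needs an injective operator, so the kernel is divided out.
    let f : X ⧸ K →L[ℂ] X := K.liftQL (S ^ n) le_rfl
    have hfr : LinearMap.range f.toLinearMap =
        LinearMap.range (S ^ n : X →L[ℂ] X).toLinearMap := by
      simp only [f, Submodule.toLinearMap_liftQL]
      exact Submodule.range_liftQ _ _ _
    have hfk : LinearMap.ker f.toLinearMap = ⊥ := by
      simp only [f, Submodule.toLinearMap_liftQL]
      exact Submodule.ker_liftQ_eq_bot _ _ _ le_rfl
    rw [← hfr]
    refine f.closed_complemented_range_of_isCompl_of_ker_eq_bot K ?_ hK hfk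
    rw [hfr]
    refine IsCompl.of_le ?_ ?_
    · rintro _ ⟨⟨y, rfl⟩, hy⟩
      have hy : (S ^ n) ((S ^ n) y) = 0 := hy
      rw [← mul_apply_eq_comp, ← pow_add] at hy
      exact hker' n n y hna hy
    · intro x _
      obtain ⟨y, hy⟩ := hran' n n x hnd
      rw [pow_add, mul_apply_eq_comp] at hy
      -- Since `S ^ n x = S ^ (2n) y`, the remainder `x - S ^ n y` is in the kernel.
      refine Submodule.mem_sup.2 ⟨(S ^ n) y, ⟨y, rfl⟩, x - (S ^ n) y, ?_, by abel⟩
      change (S ^ n) (x - (S ^ n) y) = 0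
      rw [map_sub, hy, sub_self]
  have : CompleteSpace (LinearMap.range (S ^ n : X →L[ℂ] X).toLinearMap) := hcl.completeSpace_coe
  refine ⟨n, hcl, isFredholm_of_isUnit (ContinuousLinearMap.isUnit_iff_bijective.2 ⟨?_, ?_⟩)⟩
  · refine (injective_iff_map_eq_zero _).2 ?_
    rintro ⟨_, x, rfl⟩ hx
    have hx : (S * S ^ n) x = 0 := congrArg Subtype.val hx
    rw [← pow_succ'] at hx
    exact Subtype.ext (hker n x hna hx)
  · rintro ⟨_, x, rfl⟩
    obtain ⟨y, hy⟩ := hran n x hnd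
    refine ⟨⟨(S ^ n) y, y, rfl⟩, Subtype.ext ?_⟩
    rw [pow_succ'] at hy
    exact hy

/-! ### The dichotomy at points of the plane, and poles -/

theorem notMem_spectrum_iff_isUnit (T : X →L[ℂ] X) (z : ℂ) :
    z ∉ spectrum ℂ T ↔ IsUnit (T - z • (1 : X →L[ℂ] X)) := by
  rw [spectrum.notMem_iff, Algebra.algebraMap_eq_smul_one, IsUnit.sub_iff]

theorem tendsto_sub_nhdsNE (μ : ℂ) : Tendsto (fun z => z - μ) (𝓝[≠] μ) (𝓝[≠] 0) := by
  refine tendsto_nhdsWithin_iff.2 ⟨?_, ?_⟩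
  · refine Tendsto.mono_left ?_ nhdsWithin_le_nhds
    exact (continuous_id.sub continuous_const).tendsto' _ _ (sub_self μ)
  · filter_upwards [self_mem_nhdsWithin] with z hz using sub_ne_zero.2 hz

/-- Off the B-Fredholm spectrum, a point is interior to the spectrum up to the point itself, or
is a point of meromorphy of the resolvent at which `T` is Drazin invertible. -/
theorem resolvent_dichotomy_of_notMem_bFredholmSpectrum [CompleteSpace X] {T : X →L[ℂ] X} {μ : ℂ}
    (hμ : μ ∉ bFredholmSpectrum T) :
    (∀ᶠ z in 𝓝[≠] μ, z ∈ spectrum ℂ T) ∨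
      ((∀ᶠ z in 𝓝[≠] μ, z ∉ spectrum ℂ T) ∧
        MeromorphicAt (fun z : ℂ => Ring.inverse (T - z • (1 : X →L[ℂ] X))) μ ∧
        IsDrazinInvertible (T - μ • (1 : X →L[ℂ] X))) := by
  have hBF : IsBFredholm (T - μ • (1 : X →L[ℂ] X)) := not_not.1 hμ
  have hshift : ∀ z : ℂ, T - μ • (1 : X →L[ℂ] X) - (z - μ) • (1 : X →L[ℂ] X) =
      T - z • (1 : X →L[ℂ] X) := by
    intro z
    rw [sub_smul]
    abel
  rcases resolvent_dichotomy_of_isBFredholm hBF with h | ⟨R, hR, h⟩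
  · left
    filter_upwards [(tendsto_sub_nhdsNE μ).eventually h] with z hz
    rw [hshift, ← notMem_spectrum_iff_isUnit, not_not] at hz
    exact hz
  · right
    have h' := (tendsto_sub_nhdsNE μ).eventually h
    simp only [hshift] at h'
    refine ⟨?_, ?_, isDrazinInvertible_of_meromorphicAt hR h⟩
    · filter_upwards [h'] with z hz
      exact (notMem_spectrum_iff_isUnit T z).2 (isUnit_iff_exists.2 ⟨_, hz⟩)
    · have hR' : MeromorphicAt (fun z => R (z - μ)) μ := by
        refine MeromorphicAt.comp_analyticAt (f := R) (g := fun z => z - μ) ?_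
          (analyticAt_id.sub analyticAt_const)
        simpa using hR
      refine hR'.congr ?_
      filter_upwards [h'] with z hz
      exact (Ring.inverse_unit (⟨_, _, hz.1, hz.2⟩ : (X →L[ℂ] X)ˣ)).symm

/-- A point of the spectrum at which the resolvent is meromorphic is a pole. -/
theorem isPoleOfResolvent_of_meromorphicAt {T : X →L[ℂ] X} {μ : ℂ} (hμ : μ ∈ spectrum ℂ T)
    (h : ∀ᶠ z in 𝓝[≠] μ, z ∉ spectrum ℂ T)
    (hR : MeromorphicAt (fun z : ℂ => Ring.inverse (T - z • (1 : X →L[ℂ] X))) μ) :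
    IsPoleOfResolvent T μ := by
  refine ⟨hμ, h, hR, ?_⟩
  by_contra ho
  -- Nonnegative order gives the resolvent a limit `B` at `μ`, which would invert `T - μ`.
  obtain ⟨B, hB⟩ := tendsto_nhds_of_meromorphicOrderAt_nonneg hR (not_lt.1 ho)
  have hT : Tendsto (fun z : ℂ => T - z • (1 : X →L[ℂ] X)) (𝓝[≠] μ)
      (𝓝 (T - μ • (1 : X →L[ℂ] X))) :=
    (by fun_prop : Continuous fun z : ℂ => T - z • (1 : X →L[ℂ] X)).continuousAt.tendsto.mono_left
      nhdsWithin_le_nhds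
  have h1 : (T - μ • (1 : X →L[ℂ] X)) * B = 1 := by
    refine tendsto_nhds_unique (hT.mul hB) (tendsto_const_nhds.congr' ?_)
    filter_upwards [h] with z hz
    exact (Ring.mul_inverse_cancel _ ((notMem_spectrum_iff_isUnit T z).1 hz)).symm
  have h2 : B * (T - μ • (1 : X →L[ℂ] X)) = 1 := by
    refine tendsto_nhds_unique (hB.mul hT) (tendsto_const_nhds.congr' ?_)
    filter_upwards [h] with z hz
    exact (Ring.inverse_mul_cancel _ ((notMem_spectrum_iff_isUnit T z).1 hz)).symm
  exact (notMem_spectrum_iff_isUnit T μ).2 (isUnit_iff_exists.2 ⟨B, h1, h2⟩) hμ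

/-! ### Connectedness of the complement of a finite set -/

/-- A point `ν ≠ μ` close to `μ` has a full neighbourhood avoiding `μ`, on which `P` holds. This
makes both alternatives of the dichotomy open conditions. -/
theorem isOpen_setOf_eventually_nhdsNE (P : ℂ → Prop) : IsOpen {μ | ∀ᶠ z in 𝓝[≠] μ, P z} := by
  refine isOpen_iff_mem_nhds.2 fun μ hμ => ?_
  filter_upwards [eventually_eventually_nhds.2 (eventually_nhdsWithin_iff.1 hμ)] with ν hν
  rcases eq_or_ne ν μ with rfl | hne
  · exact hμ
  · refine nhdsWithin_le_nhds ?_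
    filter_upwards [hν, isOpen_ne.mem_nhds hne] with z hz hz' using hz hz'

/-- If the B-Fredholm spectrum is finite, the points off it are isolated from the spectrum. -/
theorem eventually_notMem_spectrum_of_finite [CompleteSpace X] {T : X →L[ℂ] X}
    (hT : (bFredholmSpectrum T).Finite) {μ : ℂ} (hμ : μ ∉ bFredholmSpectrum T) :
    ∀ᶠ z in 𝓝[≠] μ, z ∉ spectrum ℂ T := by
  have hconn : IsPreconnected (bFredholmSpectrum T)ᶜ :=
    (hT.countable.isConnected_compl_of_one_lt_rank (by simp)).isPreconnected
  have hne : ((bFredholmSpectrum T)ᶜ ∩ {μ | ∀ᶠ z in 𝓝[≠] μ, z ∉ spectrum ℂ T}).Nonempty := by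
    -- A compact set does not exhaust the plane, so some point lies off both spectra.
    have hcpt : IsCompact (spectrum ℂ T ∪ bFredholmSpectrum T) :=
      (spectrum.isCompact T).union hT.isCompact
    obtain ⟨z, hz⟩ := nonempty_of_mem hcpt.compl_mem_cocompact
    rw [Set.mem_compl_iff, Set.mem_union, not_or] at hz
    exact ⟨z, hz.2, nhdsWithin_le_nhds ((spectrum.isClosed T).isOpen_compl.mem_nhds hz.1)⟩
  refine hconn.subset_left_of_subset_union (isOpen_setOf_eventually_nhdsNE _)
    (isOpen_setOf_eventually_nhdsNE (· ∈ spectrum ℂ T)) ?_ ?_ hne hμ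
  · refine Set.disjoint_left.2 fun ν h1 h2 => ?_
    rw [Set.mem_ofPred_eq] at h1 h2
    obtain ⟨z, hz1, hz2⟩ := (h1.and h2).exists
    exact hz1 hz2
  · intro ν hν
    rcases resolvent_dichotomy_of_notMem_bFredholmSpectrum hν with h | ⟨h, -⟩
    · exact Or.inr h
    · exact Or.inl h

/-- If the B-Fredholm spectrum is finite, then off it `T` is Drazin invertible and its resolvent
is meromorphic. -/
theorem isDrazinInvertible_and_meromorphicAt_of_finite [CompleteSpace X] {T : X →L[ℂ] X}
    (hT : (bFredholmSpectrum T).Finite) {μ : ℂ} (hμ : μ ∉ bFredholmSpectrum T) :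
    IsDrazinInvertible (T - μ • (1 : X →L[ℂ] X)) ∧
      MeromorphicAt (fun z : ℂ => Ring.inverse (T - z • (1 : X →L[ℂ] X))) μ := by
  rcases resolvent_dichotomy_of_notMem_bFredholmSpectrum hμ with h | ⟨-, h1, h2⟩
  · obtain ⟨z, h1, h2⟩ := (h.and (eventually_notMem_spectrum_of_finite hT hμ)).exists
    exact absurd h1 h2
  · exact ⟨h2, h1⟩

end BerkaniSpectra

theorem mainTheorem11 {X : Type*} [NormedAddCommGroup X] [NormedSpace ℂ X] [CompleteSpace X]
    (T : X →L[ℂ] X) (hT : (BerkaniSpectra.bFredholmSpectrum T).Finite) :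
    BerkaniSpectra.drazinSpectrum T = BerkaniSpectra.bFredholmSpectrum T ∧
    (∀ μ ∈ spectrum ℂ T \ BerkaniSpectra.bFredholmSpectrum T,
      BerkaniSpectra.IsPoleOfResolvent T μ) ∧
    IsDiscrete (spectrum ℂ T \ BerkaniSpectra.bFredholmSpectrum T) ∧
    derivedSet (spectrum ℂ T) ⊆ BerkaniSpectra.bFredholmSpectrum T := by
  refine ⟨Set.Subset.antisymm ?_ ?_, ?_, ?_, ?_⟩
  · intro μ hμ
    by_contra h
    exact hμ (BerkaniSpectra.isDrazinInvertible_and_meromorphicAt_of_finite hT h).1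
  · exact fun μ hμ h => hμ (BerkaniSpectra.isBFredholm_of_isDrazinInvertible h)
  · exact fun μ hμ => BerkaniSpectra.isPoleOfResolvent_of_meromorphicAt hμ.1
      (BerkaniSpectra.eventually_notMem_spectrum_of_finite hT hμ.2)
      (BerkaniSpectra.isDrazinInvertible_and_meromorphicAt_of_finite hT hμ.2).2
  · refine isDiscrete_iff_nhdsNE.2 fun μ hμ => ?_
    rw [← disjoint_iff, Filter.disjoint_principal_right]
    filter_upwards [BerkaniSpectra.eventually_notMem_spectrum_of_finite hT hμ.2] with z hz h
    exact hz h.1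
  · intro μ hμ
    by_contra h
    -- Off `σ_BF(T)` a punctured neighbourhood misses the spectrum, so no accumulation is possible.
    exact accPt_iff_frequently_nhdsNE.1 hμ
      (BerkaniSpectra.eventually_notMem_spectrum_of_finite hT h)
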